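/- Let $M$ be a smooth Riemannian manifold (Hausdorff, second countable, without boundary) and let $\Omega\subset M$ be a domain, i.e. a nonempty connected open subset, whose closure is compact. Let $L^2_{1,0}(\Omega)\subset L^2(\Omega)$ be the completion of $C^\infty_0(\Omega)$, the space of smooth real functions with compact support in $\Omega$, with respect to the norm $\|\varphi\|^2=\int_\Omega\varphi^2+\int_\Omega|\nabla\varphi|^2$ (gradient, norm and integrals being those of the Riemannian metric and its volume measure), and let $$\lambda_1(\Omega)=\inf\left\{\frac{\int_\Omega|\nabla f|^2}{\int_\Omega f^2}\;:\; f\in L^2_{1,0}(\Omega)\setminus\{0\}\right\}.$$ Let $X$ be a smooth vector field on $M$ such that $\sup_\Omega|X|<\infty$ and $\inf_\Omega \operatorname{div}X>0$. Then $$\lambda_1(\Omega)\;\ge\;\left[\frac{\inf_\Omega\operatorname{div}X}{2\,\sup_\Omega|X|}\right]^2\;>\;0 .$$ -/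

import Mathlib

open MeasureTheory Filter Topology Bundle
open scoped Manifold ContDiff

noncomputable section

namespace RiemannianEigenvalue

variable {n : ℕ} {M : Type*} [TopologicalSpace M] [ChartedSpace (EuclideanSpace ℝ (Fin n)) M]

variable (n) in
/-- Membership in `C^∞_0(Ω)`: smooth functions with compact support in `Ω`. -/
structure IsTestFunction (Ω : Set M) (φ : M → ℝ) : Prop where
  smooth : ContMDiff (𝓡 n) 𝓘(ℝ, ℝ) ∞ φ
  hasCompactSupport : HasCompactSupport φ
  tsupport_subset : tsupport φ ⊆ Ω

/-- The coordinate vector field `∂/∂yⁱ` of the chart around `c`, at the point of coordinates `y`. -/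
def coordField (c : M) (i : Fin n) (y : EuclideanSpace ℝ (Fin n)) :
    TangentSpace (𝓡 n) ((extChartAt (𝓡 n) c).symm y) :=
  mfderiv (𝓡 n) (𝓡 n) (extChartAt (𝓡 n) c).symm y (EuclideanSpace.single i (1 : ℝ))

/-- The `i`-th component of the vector field `X` in the chart around `c`, as a function of the
coordinates `y`. -/
def coordComponent (X : Π x : M, TangentSpace (𝓡 n) x) (c : M) (i : Fin n)
    (y : EuclideanSpace ℝ (Fin n)) : ℝ :=
  (show EuclideanSpace ℝ (Fin n) from
    mfderiv (𝓡 n) (𝓡 n) (extChartAt (𝓡 n) c) ((extChartAt (𝓡 n) c).symm y)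
      (X ((extChartAt (𝓡 n) c).symm y))) i

variable [RiemannianBundle (fun x : M ↦ TangentSpace (𝓡 n) x)]

/-- The matrix `g_ij` of the metric in the chart around `c`, at the point of coordinates `y`. -/
def metricMatrix (c : M) (y : EuclideanSpace ℝ (Fin n)) : Matrix (Fin n) (Fin n) ℝ :=
  Matrix.of fun i j ↦ inner ℝ (coordField c i y) (coordField c j y)

/-- The Riemannian volume density `√(det g_ij)` in the chart around `c`. -/
def volumeDensity (c : M) (y : EuclideanSpace ℝ (Fin n)) : ℝ :=
  √(metricMatrix c y).det

variable (n) in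
/-- The measure `√(det g_ij) dy¹ ⋯ dyⁿ` on the domain of the chart around `c`, seen as a measure
on `M` that vanishes outside this domain. -/
def chartVolume [MeasurableSpace M] (c : M) : Measure M :=
  ((volume.restrict (extChartAt (𝓡 n) c).target).withDensity
    fun y ↦ ENNReal.ofReal (volumeDensity c y)).map (extChartAt (𝓡 n) c).symm

variable (n M) in
/-- The Riemannian volume measure. Any two of the measures `chartVolume n c` agree on the
intersection of the two chart domains, so that their supremum in the lattice of measures is the
measure on `M` which is given by `√(det g_ij) dy¹ ⋯ dyⁿ` in each chart. -/
def riemannianVolume [MeasurableSpace M] : Measure M :=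
  ⨆ c : M, chartVolume n c

/-- The divergence of a vector field, `div X = (1 / √g) ∑ᵢ ∂(√g Xⁱ)/∂yⁱ` with `g = det g_ij`. Its
value at `p` is computed in the preferred chart around `p`; any other chart gives the same value. -/
def divergence (X : Π x : M, TangentSpace (𝓡 n) x) (p : M) : ℝ :=
  (volumeDensity p (extChartAt (𝓡 n) p p))⁻¹ *
    ∑ i : Fin n, fderiv ℝ (fun y ↦ volumeDensity p y * coordComponent X p i y)
      (extChartAt (𝓡 n) p p) (EuclideanSpace.single i (1 : ℝ))

variable (n) in
/-- The Riemannian gradient: `⟪grad f, v⟫ = df(v)` for all tangent vectors `v`. -/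
def riemannianGradient (f : M → ℝ) (x : M) : TangentSpace (𝓡 n) x :=
  haveI : FiniteDimensional ℝ (TangentSpace (𝓡 n) x) :=
    inferInstanceAs (FiniteDimensional ℝ (EuclideanSpace ℝ (Fin n)))
  haveI : CompleteSpace (TangentSpace (𝓡 n) x) := FiniteDimensional.complete ℝ _
  (InnerProductSpace.toDual ℝ (TangentSpace (𝓡 n) x)).symm (mvfderiv (𝓡 n) f x)

variable [MeasurableSpace M]

variable (n) in
/-- `∫_Ω |∇φ|²` for smooth `φ`. -/
def gradientIntegral (Ω : Set M) (φ : M → ℝ) : ℝ :=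
  ∫ x in Ω, ‖riemannianGradient n φ x‖ ^ 2 ∂(riemannianVolume n M)

variable (n) in
/-- The square `∫_Ω φ² + ∫_Ω |∇φ|²` of the norm on `C^∞_0(Ω)`. -/
def sobolevNormSq (Ω : Set M) (φ : M → ℝ) : ℝ :=
  (∫ x in Ω, φ x ^ 2 ∂(riemannianVolume n M)) + gradientIntegral n Ω φ

variable (n) in
/-- `f` belongs to `L²_{1,0}(Ω)`, the completion of `C^∞_0(Ω)`, and `∫_Ω |∇f|² = D`. The element
`f` of the completion is given by a Cauchy sequence `φ` in `C^∞_0(Ω)`, and is identified with the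
limit of `φ` in `L²(Ω)`; the integral `∫_Ω |∇·|²` is extended to the completion by continuity. -/
def HasDirichletEnergy (Ω : Set M) (f : M → ℝ) (D : ℝ) : Prop :=
  MemLp f 2 ((riemannianVolume n M).restrict Ω) ∧
  ∃ φ : ℕ → M → ℝ, (∀ k, IsTestFunction n Ω (φ k)) ∧
    (∀ ε > 0, ∃ N, ∀ j ≥ N, ∀ k ≥ N, sobolevNormSq n Ω (φ j - φ k) < ε) ∧
    Tendsto (fun k ↦ eLpNorm (φ k - f) 2 ((riemannianVolume n M).restrict Ω)) atTop (𝓝 0) ∧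
    Tendsto (fun k ↦ gradientIntegral n Ω (φ k)) atTop (𝓝 D)

variable (n) in
/-- The first eigenvalue of `Ω`: the infimum of the Rayleigh quotients `∫_Ω |∇f|² / ∫_Ω f²` over
the nonzero elements `f` of `L²_{1,0}(Ω)`. -/
def firstEigenvalue (Ω : Set M) : ℝ :=
  sInf {R : ℝ | ∃ (f : M → ℝ) (D : ℝ), HasDirichletEnergy n Ω f D ∧
    ¬ f =ᵐ[(riemannianVolume n M).restrict Ω] 0 ∧
    R = D / ∫ x in Ω, f x ^ 2 ∂(riemannianVolume n M)}

end RiemannianEigenvalue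

end

open MeasureTheory Filter Topology Bundle
open scoped Manifold ContDiff

noncomputable section

namespace RiemannianEigenvalue

variable {n : ℕ} {M : Type*} [TopologicalSpace M] [ChartedSpace (EuclideanSpace ℝ (Fin n)) M]

/-! ### Coordinate fields, components and the metric in a chart -/

section Charts

variable [IsManifold (𝓡 n) ∞ M]

/-! Write h = inf div X and B = sup |X| over Ω. For a test function φ on Ω, the divergence theorem
applied to φ² gives h ∫ φ² ≤ ∫ φ² div X = -2 ∫ φ ⟨∇φ, X⟩ ≤ 2B ∫ |φ| |∇φ|. A weighted Young
inequality lets half of the left side absorb the φ² term, which leaves h² ∫ φ² ≤ 4B² ∫ |∇φ|²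
(`IsTestFunction.sq_mul_integral_sq_le`). Both integrals converge along the sequences that define
L²_{1,0}(Ω), so the inequality passes to the completion.

Most of the work is the divergence theorem `integral_divergence_mul` for a volume and a divergence
given by charts. Change of variables shows that the chart volumes agree on overlaps
(`chartVolume_eq_of_subset`), so that their supremum restricts to each of them
(`riemannianVolume_restrict_source`). Inside one chart the theorem is integration by parts in ℝⁿ
(`integral_chartDivergence_mul`). The term ∫ du(X) in it does not depend on the chart, and this
forces the local expressions of the divergence to agree (`chartDivergence_le`). A partition of unity
then globalizes the identity. -/

lemma mdifferentiableAt_extChartAt_symm {c : M} {y : EuclideanSpace ℝ (Fin n)}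
    (hy : y ∈ (extChartAt (𝓡 n) c).target) :
    MDifferentiableAt (𝓡 n) (𝓡 n) (extChartAt (𝓡 n) c).symm y :=
  ((contMDiffOn_extChartAt_symm (I := 𝓡 n) (n := ∞) c).contMDiffAt
    ((isOpen_extChartAt_target c).mem_nhds hy)).mdifferentiableAt (by simp)

/-- The field is the tangent map of the smooth inverse chart applied to a constant section. -/
lemma contMDiffOn_coordField (c : M) (i : Fin n) :
    ContMDiffOn (𝓡 n) (𝓡 n).tangent ∞
      (fun y ↦ (⟨(extChartAt (𝓡 n) c).symm y, coordField c i y⟩ : TangentBundle (𝓡 n) M))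
      (extChartAt (𝓡 n) c).target := by
  have ho : IsOpen (extChartAt (𝓡 n) c).target := isOpen_extChartAt_target c
  have h1 := (contMDiffOn_extChartAt_symm (I := 𝓡 n) (n := ∞) c).contMDiffOn_tangentMapWithin
    (m := ∞) le_rfl ho.uniqueMDiffOn
  have h2 : ContMDiffOn (𝓡 n) (𝓡 n).tangent ∞
      (fun y : EuclideanSpace ℝ (Fin n) ↦
        (⟨y, EuclideanSpace.single i (1 : ℝ)⟩ : TangentBundle (𝓡 n) (EuclideanSpace ℝ (Fin n))))
      (extChartAt (𝓡 n) c).target :=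
    contMDiffOn_vectorSpace_iff_contDiffOn.2 contDiffOn_const
  refine (h1.comp h2 fun y hy ↦ hy).congr fun y hy ↦ ?_
  simp only [Function.comp, tangentMapWithin, coordField]
  rw [mfderivWithin_of_isOpen ho hy]

lemma mfderiv_symm_comp_mfderiv {c : M} {y : EuclideanSpace ℝ (Fin n)}
    (hy : y ∈ (extChartAt (𝓡 n) c).target) :
    (mfderiv (𝓡 n) (𝓡 n) (extChartAt (𝓡 n) c).symm y) ∘L
      (mfderiv (𝓡 n) (𝓡 n) (extChartAt (𝓡 n) c) ((extChartAt (𝓡 n) c).symm y)) =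
        ContinuousLinearMap.id _ _ := by
  have := mfderivWithin_extChartAt_symm_comp_mfderiv_extChartAt (I := 𝓡 n) hy
  simpa using this

lemma mfderiv_comp_mfderiv_symm {c : M} {y : EuclideanSpace ℝ (Fin n)}
    (hy : y ∈ (extChartAt (𝓡 n) c).target) :
    (mfderiv (𝓡 n) (𝓡 n) (extChartAt (𝓡 n) c) ((extChartAt (𝓡 n) c).symm y)) ∘L
      (mfderiv (𝓡 n) (𝓡 n) (extChartAt (𝓡 n) c).symm y) = ContinuousLinearMap.id _ _ := by
  have := mfderiv_extChartAt_comp_mfderivWithin_extChartAt_symm (I := 𝓡 n) hy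
  simpa using this

omit [IsManifold (𝓡 n) ∞ M] in
lemma mfderiv_symm_apply {c : M} (y v : EuclideanSpace ℝ (Fin n)) :
    mfderiv (𝓡 n) (𝓡 n) (extChartAt (𝓡 n) c).symm y v = ∑ i, v i • coordField c i y := by
  conv_lhs => rw [← (EuclideanSpace.basisFun (Fin n) ℝ).sum_repr v]
  unfold coordField
  erw [map_sum]
  refine Finset.sum_congr rfl fun i _ ↦ ?_
  erw [map_smul]
  simp

lemma sum_coordComponent_smul (X : Π x : M, TangentSpace (𝓡 n) x) {c : M}
    {y : EuclideanSpace ℝ (Fin n)} (hy : y ∈ (extChartAt (𝓡 n) c).target) :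
    ∑ i, coordComponent X c i y • coordField c i y = X ((extChartAt (𝓡 n) c).symm y) := by
  have h := DFunLike.congr_fun (mfderiv_symm_comp_mfderiv hy) (X ((extChartAt (𝓡 n) c).symm y))
  exact (mfderiv_symm_apply y _).symm.trans h

lemma linearIndependent_coordField {c : M} {y : EuclideanSpace ℝ (Fin n)}
    (hy : y ∈ (extChartAt (𝓡 n) c).target) :
    LinearIndependent ℝ fun i ↦ coordField c i y := by
  rw [Fintype.linearIndependent_iff]
  intro a ha i
  have h1 := (mfderiv_symm_apply (c := c) y (WithLp.toLp 2 a)).trans ha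
  have h2 := DFunLike.congr_fun (mfderiv_comp_mfderiv_symm hy) (WithLp.toLp 2 a)
  have h3 : (WithLp.toLp 2 a : EuclideanSpace ℝ (Fin n)) = 0 := by
    exact h2.symm.trans ((congrArg _ h1).trans (map_zero
      (mfderiv (𝓡 n) (𝓡 n) (extChartAt (𝓡 n) c) ((extChartAt (𝓡 n) c).symm y))))
  simpa using congrArg (fun v : EuclideanSpace ℝ (Fin n) ↦ v i) h3

lemma contDiffOn_coordComponent {X : Π x : M, TangentSpace (𝓡 n) x}
    (hX : ContMDiff (𝓡 n) (𝓡 n).tangent ∞ (fun x ↦ (⟨x, X x⟩ : TangentBundle (𝓡 n) M)))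
    (c : M) (i : Fin n) :
    ContDiffOn ℝ ∞ (coordComponent X c i) (extChartAt (𝓡 n) c).target := by
  have ho : IsOpen (chartAt (EuclideanSpace ℝ (Fin n)) c).source := (chartAt _ c).open_source
  have h1 := (contMDiffOn_extChartAt (I := 𝓡 n) (n := ∞) (x := c)).contMDiffOn_tangentMapWithin
    (m := ∞) le_rfl ho.uniqueMDiffOn
  have h2 : ContMDiffOn (𝓡 n) (𝓡 n).tangent ∞
      (fun y ↦ (⟨(extChartAt (𝓡 n) c).symm y, X ((extChartAt (𝓡 n) c).symm y)⟩ :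
        TangentBundle (𝓡 n) M)) (extChartAt (𝓡 n) c).target :=
    hX.comp_contMDiffOn (contMDiffOn_extChartAt_symm c)
  have hm : ∀ y ∈ (extChartAt (𝓡 n) c).target, (extChartAt (𝓡 n) c).symm y ∈
      (chartAt (EuclideanSpace ℝ (Fin n)) c).source := fun y hy ↦ by
    simpa using (extChartAt (𝓡 n) c).map_target hy
  have h3 : ContMDiffOn (𝓡 n) (𝓡 n).tangent ∞
      (fun y ↦ (⟨y, mfderiv (𝓡 n) (𝓡 n) (extChartAt (𝓡 n) c) ((extChartAt (𝓡 n) c).symm y)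
      (X ((extChartAt (𝓡 n) c).symm y))⟩ : TangentBundle (𝓡 n) (EuclideanSpace ℝ (Fin n))))
      (extChartAt (𝓡 n) c).target := by
    refine (h1.comp h2 hm).congr fun y hy ↦ ?_
    simp only [Function.comp, tangentMapWithin]
    rw [mfderivWithin_of_isOpen ho (hm y hy), (extChartAt (𝓡 n) c).right_inv hy]
  have h4 := contMDiffOn_vectorSpace_iff_contDiffOn.1 h3
  exact (EuclideanSpace.proj i : EuclideanSpace ℝ (Fin n) →L[ℝ] ℝ).contDiff.comp_contDiffOn h4

lemma mvfderiv_coordField {u : M → ℝ} {c : M} {y : EuclideanSpace ℝ (Fin n)}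
    (hy : y ∈ (extChartAt (𝓡 n) c).target)
    (hu : MDifferentiableAt (𝓡 n) 𝓘(ℝ, ℝ) u ((extChartAt (𝓡 n) c).symm y)) (i : Fin n) :
    mvfderiv (𝓡 n) u ((extChartAt (𝓡 n) c).symm y) (coordField c i y) =
      fderiv ℝ (u ∘ (extChartAt (𝓡 n) c).symm) y (EuclideanSpace.single i (1 : ℝ)) := by
  have h := mvfderiv_comp_apply y hu (mdifferentiableAt_extChartAt_symm hy)
    (EuclideanSpace.single i (1 : ℝ))
  refine h.symm.trans ?_
  rw [mvfderiv, mfderiv_eq_fderiv]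
  rfl

/-- The expression `∑ᵢ Xⁱ ∂ᵢ u` of `du(X)` in a chart. -/
lemma mvfderiv_eq_sum {u : M → ℝ} (X : Π x : M, TangentSpace (𝓡 n) x) {c : M}
    {y : EuclideanSpace ℝ (Fin n)} (hy : y ∈ (extChartAt (𝓡 n) c).target)
    (hu : MDifferentiableAt (𝓡 n) 𝓘(ℝ, ℝ) u ((extChartAt (𝓡 n) c).symm y)) :
    mvfderiv (𝓡 n) u ((extChartAt (𝓡 n) c).symm y) (X ((extChartAt (𝓡 n) c).symm y)) =
      ∑ i, coordComponent X c i y *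
        fderiv ℝ (u ∘ (extChartAt (𝓡 n) c).symm) y (EuclideanSpace.single i (1 : ℝ)) := by
  conv_lhs => rw [← sum_coordComponent_smul X hy]
  rw [map_sum]
  refine Finset.sum_congr rfl fun i _ ↦ ?_
  rw [map_smul, mvfderiv_coordField hy hu, smul_eq_mul]

lemma contDiffOn_comp_symm {u : M → ℝ} (hu : ContMDiff (𝓡 n) 𝓘(ℝ, ℝ) ∞ u) (c : M) :
    ContDiffOn ℝ ∞ (u ∘ (extChartAt (𝓡 n) c).symm) (extChartAt (𝓡 n) c).target :=
  contMDiffOn_iff_contDiffOn.1 (hu.comp_contMDiffOn (contMDiffOn_extChartAt_symm c))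

section Metric

variable [RiemannianBundle (fun x : M ↦ TangentSpace (𝓡 n) x)]

lemma posDef_metricMatrix {c : M} {y : EuclideanSpace ℝ (Fin n)}
    (hy : y ∈ (extChartAt (𝓡 n) c).target) : (metricMatrix c y).PosDef :=
  Matrix.posDef_gram_of_linearIndependent (𝕜 := ℝ) (linearIndependent_coordField hy)

lemma volumeDensity_pos {c : M} {y : EuclideanSpace ℝ (Fin n)}
    (hy : y ∈ (extChartAt (𝓡 n) c).target) : 0 < volumeDensity c y :=
  Real.sqrt_pos.2 (posDef_metricMatrix hy).det_pos

variable [IsContMDiffRiemannianBundle (𝓡 n) ∞ (EuclideanSpace ℝ (Fin n))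
  (fun x : M ↦ TangentSpace (𝓡 n) x)]

lemma contDiffOn_metricMatrix (c : M) (i j : Fin n) :
    ContDiffOn ℝ ∞ (fun y ↦ metricMatrix c y i j) (extChartAt (𝓡 n) c).target :=
  contMDiffOn_iff_contDiffOn.1
    (ContMDiffOn.inner_bundle (contMDiffOn_coordField c i) (contMDiffOn_coordField c j))

lemma contDiffOn_det {E : Type*} [NormedAddCommGroup E] [NormedSpace ℝ E] {k : ℕ∞ω}
    {s : Set E} {A : E → Matrix (Fin n) (Fin n) ℝ}
    (hA : ∀ i j, ContDiffOn ℝ k (fun y ↦ A y i j) s) :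
    ContDiffOn ℝ k (fun y ↦ (A y).det) s := by
  simp only [Matrix.det_apply]
  refine ContDiffOn.sum fun σ _ ↦ ContDiffOn.const_smul _ ?_
  exact contDiffOn_prod fun i _ ↦ hA _ _

lemma contDiffOn_volumeDensity (c : M) :
    ContDiffOn ℝ ∞ (fun y ↦ volumeDensity c y) (extChartAt (𝓡 n) c).target :=
  (contDiffOn_det (contDiffOn_metricMatrix c)).sqrt
    fun _ hy ↦ (posDef_metricMatrix hy).det_pos.ne'

end Metric

end Charts

/-! ### Change of charts and the Riemannian volume measure -/

section Volume

variable [IsManifold (𝓡 n) ∞ M] [RiemannianBundle (fun x : M ↦ TangentSpace (𝓡 n) x)]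

/-- The derivative of the coordinate change from the chart around `c` to the chart around `c'`. -/
def coordChangeDeriv (c c' : M) (y : EuclideanSpace ℝ (Fin n)) :
    EuclideanSpace ℝ (Fin n) →L[ℝ] EuclideanSpace ℝ (Fin n) :=
  (mfderiv (𝓡 n) (𝓡 n) (extChartAt (𝓡 n) c') ((extChartAt (𝓡 n) c).symm y)) ∘L
    (mfderiv (𝓡 n) (𝓡 n) (extChartAt (𝓡 n) c).symm y)

omit [RiemannianBundle (fun x : M ↦ TangentSpace (𝓡 n) x)] in
lemma hasFDerivAt_coordChange {c c' : M} {y : EuclideanSpace ℝ (Fin n)}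
    (hy : y ∈ (extChartAt (𝓡 n) c).target)
    (hy' : (extChartAt (𝓡 n) c).symm y ∈ (extChartAt (𝓡 n) c').source) :
    HasFDerivAt (extChartAt (𝓡 n) c' ∘ (extChartAt (𝓡 n) c).symm) (coordChangeDeriv c c' y) y := by
  have h1 := (mdifferentiableAt_extChartAt_symm hy).hasMFDerivAt
  have h2 := (mdifferentiableAt_extChartAt (I := 𝓡 n) (x := c')
    (by simpa using hy')).hasMFDerivAt
  exact (h2.comp y h1).hasFDerivAt

omit [IsManifold (𝓡 n) ∞ M] in
lemma metricMatrix_apply_of_symm_eq {c x : M} {y : EuclideanSpace ℝ (Fin n)}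
    (hx : (extChartAt (𝓡 n) c).symm y = x) (i j : Fin n) :
    metricMatrix c y i j =
      inner ℝ (show TangentSpace (𝓡 n) x from coordField c i y)
        (show TangentSpace (𝓡 n) x from coordField c j y) := by
  subst hx
  rfl

lemma _root_.inner_sum_smul_sum_smul {ι V : Type*} [Fintype ι] [NormedAddCommGroup V]
    [InnerProductSpace ℝ V] (a b : ι → ℝ) (v : ι → V) :
    inner ℝ (∑ i, a i • v i) (∑ j, b j • v j) = ∑ i, ∑ j, a i * b j * inner ℝ (v i) (v j) := by
  simp only [sum_inner, inner_sum, inner_smul_left, inner_smul_right, conj_trivial, Finset.mul_sum]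
  rw [Finset.sum_comm]
  exact Finset.sum_congr rfl fun i _ ↦ Finset.sum_congr rfl fun j _ ↦ by ring

/-- With J the Jacobian matrix of the coordinate change, the i-th coordinate field of `c` is the
combination of those of `c'` with coefficients the i-th column of J. A Gram matrix therefore changes
by the congruence Jᵀ g' J. -/
lemma metricMatrix_change {c c' : M} {y : EuclideanSpace ℝ (Fin n)}
    (hy' : (extChartAt (𝓡 n) c).symm y ∈ (extChartAt (𝓡 n) c').source) :
    metricMatrix c y =
      ((coordChangeDeriv c c' y).toLinearMap.toMatrix
        (EuclideanSpace.basisFun (Fin n) ℝ).toBasis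
          (EuclideanSpace.basisFun (Fin n) ℝ).toBasis).transpose *
        metricMatrix c' (extChartAt (𝓡 n) c' ((extChartAt (𝓡 n) c).symm y)) *
      ((coordChangeDeriv c c' y).toLinearMap.toMatrix
        (EuclideanSpace.basisFun (Fin n) ℝ).toBasis
          (EuclideanSpace.basisFun (Fin n) ℝ).toBasis) := by
  set x := (extChartAt (𝓡 n) c).symm y with hx
  set z := extChartAt (𝓡 n) c' x with hz
  have hzx : (extChartAt (𝓡 n) c').symm z = x := (extChartAt (𝓡 n) c').left_inv hy'
  have hzt : z ∈ (extChartAt (𝓡 n) c').target := (extChartAt (𝓡 n) c').map_source hy'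
  set J := (coordChangeDeriv c c' y).toLinearMap.toMatrix
        (EuclideanSpace.basisFun (Fin n) ℝ).toBasis
          (EuclideanSpace.basisFun (Fin n) ℝ).toBasis with hJ
  have key : ∀ i, (show TangentSpace (𝓡 n) x from coordField c i y) =
      ∑ k, J k i • (show TangentSpace (𝓡 n) x from coordField c' k z) := by
    intro i
    have h1 := mfderiv_symm_comp_mfderiv (M := M) hzt
    rw [hzx] at h1
    have h2 := DFunLike.congr_fun h1 (coordField c i y)
    have h3 := mfderiv_symm_apply (c := c') z
      (coordChangeDeriv c c' y (EuclideanSpace.single i (1 : ℝ)))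
    refine (h2.symm.trans h3).trans ?_
    refine Finset.sum_congr rfl fun k _ ↦ ?_
    simp [hJ, LinearMap.toMatrix_apply]
    rfl
  ext i j
  rw [metricMatrix_apply_of_symm_eq hx.symm, key i, key j]
  refine (inner_sum_smul_sum_smul (fun k ↦ J k i) (fun k ↦ J k j) _).trans ?_
  simp only [Matrix.mul_apply, Matrix.transpose_apply, Finset.sum_mul]
  rw [Finset.sum_comm]
  refine Finset.sum_congr rfl fun k _ ↦ Finset.sum_congr rfl fun l _ ↦ ?_
  rw [metricMatrix_apply_of_symm_eq hzx]
  ring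

lemma volumeDensity_change {c c' : M} {y : EuclideanSpace ℝ (Fin n)}
    (hy' : (extChartAt (𝓡 n) c).symm y ∈ (extChartAt (𝓡 n) c').source) :
    volumeDensity c y = |(coordChangeDeriv c c' y).det| *
      volumeDensity c' (extChartAt (𝓡 n) c' ((extChartAt (𝓡 n) c).symm y)) := by
  rw [volumeDensity, metricMatrix_change hy', Matrix.det_mul, Matrix.det_mul,
    Matrix.det_transpose, LinearMap.det_toMatrix, mul_right_comm, ← sq,
    Real.sqrt_mul (sq_nonneg _), Real.sqrt_sq_eq_abs]
  rfl

variable [MeasurableSpace M] [BorelSpace M]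

omit [IsManifold (𝓡 n) ∞ M] [RiemannianBundle (fun x : M ↦ TangentSpace (𝓡 n) x)] in
lemma measurableSet_chart_preimage (c : M) {s : Set M} (hs : MeasurableSet s) :
    MeasurableSet ((extChartAt (𝓡 n) c).target ∩ (extChartAt (𝓡 n) c).symm ⁻¹' s) := by
  have ho : IsOpen (extChartAt (𝓡 n) c).target := isOpen_extChartAt_target c
  have h := (continuousOn_iff_continuous_domRestrict.1
    (continuousOn_extChartAt_symm (I := 𝓡 n) c)).measurable hs
  have := ho.measurableSet.subtype_image h
  convert this using 1
  ext y
  simp [and_comm]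

omit [IsManifold (𝓡 n) ∞ M] [RiemannianBundle (fun x : M ↦ TangentSpace (𝓡 n) x)] in
lemma aemeasurable_extChartAt_symm (c : M) :
    AEMeasurable (extChartAt (𝓡 n) c).symm (volume.restrict (extChartAt (𝓡 n) c).target) :=
  (continuousOn_extChartAt_symm (I := 𝓡 n) c).aemeasurable
    (isOpen_extChartAt_target c).measurableSet

omit [IsManifold (𝓡 n) ∞ M] in
lemma chartVolume_apply (c : M) {s : Set M} (hs : MeasurableSet s) :
    chartVolume n c s =
      ∫⁻ y in (extChartAt (𝓡 n) c).target ∩ (extChartAt (𝓡 n) c).symm ⁻¹' s,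
        ENNReal.ofReal (volumeDensity c y) := by
  rw [chartVolume, Measure.map_apply_of_aemeasurable
    ((aemeasurable_extChartAt_symm c).mono_ac (withDensity_absolutelyContinuous _ _)) hs,
    withDensity_apply', Measure.restrict_restrict' (isOpen_extChartAt_target c).measurableSet,
    Set.inter_comm]

omit [IsManifold (𝓡 n) ∞ M] in
lemma chartVolume_inter_source (c : M) {s : Set M} (hs : MeasurableSet s) :
    chartVolume n c (s ∩ (extChartAt (𝓡 n) c).source) = chartVolume n c s := by
  rw [chartVolume_apply c hs,
    chartVolume_apply c (hs.inter (isOpen_extChartAt_source c).measurableSet)]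
  congr 2
  ext y
  simp only [Set.mem_inter_iff, Set.mem_preimage]
  exact ⟨fun h ↦ ⟨h.1, h.2.1⟩, fun h ↦ ⟨h.1, h.2, (extChartAt (𝓡 n) c).map_target h.1⟩⟩

/-- The factor |det J| in the transformation of the density is exactly the one produced by the
change of variables formula. -/
lemma chartVolume_eq_of_subset {c c' : M} {s : Set M} (hs : MeasurableSet s)
    (h : s ⊆ (extChartAt (𝓡 n) c).source) (h' : s ⊆ (extChartAt (𝓡 n) c').source) :
    chartVolume n c s = chartVolume n c' s := by
  rw [chartVolume_apply c hs, chartVolume_apply c' hs]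
  set A := (extChartAt (𝓡 n) c).target ∩ (extChartAt (𝓡 n) c).symm ⁻¹' s with hA
  have himage : (extChartAt (𝓡 n) c').target ∩ (extChartAt (𝓡 n) c').symm ⁻¹' s =
      (extChartAt (𝓡 n) c' ∘ (extChartAt (𝓡 n) c).symm) '' A := by
    ext z
    constructor
    · rintro ⟨hz, hzs⟩
      refine ⟨extChartAt (𝓡 n) c ((extChartAt (𝓡 n) c').symm z),
        ⟨(extChartAt (𝓡 n) c).map_source (h hzs), ?_⟩, ?_⟩
      · rw [Set.mem_preimage, (extChartAt (𝓡 n) c).left_inv (h hzs)]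
        exact hzs
      · rw [Function.comp_apply, (extChartAt (𝓡 n) c).left_inv (h hzs),
          (extChartAt (𝓡 n) c').right_inv hz]
    · rintro ⟨y, ⟨hy, hys⟩, rfl⟩
      refine ⟨(extChartAt (𝓡 n) c').map_source (h' hys), ?_⟩
      rw [Set.mem_preimage, Function.comp_apply, (extChartAt (𝓡 n) c').left_inv (h' hys)]
      exact hys
  have hinj : Set.InjOn (extChartAt (𝓡 n) c' ∘ (extChartAt (𝓡 n) c).symm) A :=
    ((extChartAt (𝓡 n) c').injOn.comp ((extChartAt (𝓡 n) c).symm.injOn.mono Set.inter_subset_left)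
      fun y hy ↦ h' hy.2)
  have hAm : MeasurableSet A := measurableSet_chart_preimage c hs
  rw [himage, lintegral_image_eq_lintegral_abs_det_fderiv_mul volume hAm
    (fun y hy ↦ (hasFDerivAt_coordChange hy.1 (h' hy.2)).hasFDerivWithinAt) hinj]
  refine setLIntegral_congr_fun hAm fun y hy ↦ ?_
  simp only [Function.comp_apply]
  rw [volumeDensity_change (h' hy.2), ENNReal.ofReal_mul (abs_nonneg _)]

variable [SecondCountableTopology M]

variable (n M) in
omit [IsManifold (𝓡 n) ∞ M] [RiemannianBundle (fun x : M ↦ TangentSpace (𝓡 n) x)] in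
lemma exists_chart_partition [Nonempty M] :
    ∃ (c : ℕ → M) (A : ℕ → Set M), (∀ i, MeasurableSet (A i)) ∧
      (∀ i, A i ⊆ (extChartAt (𝓡 n) (c i)).source) ∧ Pairwise (Function.onFun Disjoint A) ∧
      ⋃ i, A i = Set.univ := by
  obtain ⟨s, hs, hsU⟩ := TopologicalSpace.countable_cover_nhds
    (f := fun c : M ↦ (extChartAt (𝓡 n) c).source) fun c ↦ extChartAt_source_mem_nhds c
  have hne : s.Nonempty := by
    by_contra h
    rw [Set.not_nonempty_iff_eq_empty] at h
    subst h
    exact Set.empty_ne_univ (by simpa using hsU)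
  obtain ⟨c, rfl⟩ := hs.exists_eq_range hne
  refine ⟨c, disjointed fun i ↦ (extChartAt (𝓡 n) (c i)).source,
    MeasurableSet.disjointed fun i ↦ (isOpen_extChartAt_source (c i)).measurableSet,
    disjointed_le _, disjoint_disjointed _, ?_⟩
  rw [iUnion_disjointed]
  simpa using hsU

/-- A supremum of measures is not computed set by set, so the upper bound needs a competitor. Gluing
the chart volumes along a countable measurable partition gives a measure `ν` that dominates every
chart volume and equals it on sets inside the chart domain. -/
lemma riemannianVolume_apply_of_subset {c : M} {s : Set M} (hs : MeasurableSet s)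
    (h : s ⊆ (extChartAt (𝓡 n) c).source) :
    riemannianVolume n M s = chartVolume n c s := by
  have : Nonempty M := ⟨c⟩
  refine le_antisymm ?_ (le_iSup (fun c : M ↦ chartVolume n c) c s)
  obtain ⟨d, A, hAm, hAs, hAd, hAU⟩ := exists_chart_partition n M
  set ν : Measure M := Measure.sum fun i ↦ (chartVolume n (d i)).restrict (A i) with hν
  have key : ∀ (e : M) {t : Set M}, MeasurableSet t → t ⊆ (extChartAt (𝓡 n) e).source →
      ν t = chartVolume n e t := by
    intro e t ht hte
    have h1 : t = ⋃ i, t ∩ A i := by rw [← Set.inter_iUnion, hAU, Set.inter_univ]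
    conv_rhs => rw [h1, measure_iUnion
      (fun i j hij ↦ (hAd hij).mono Set.inter_subset_right Set.inter_subset_right)
      (fun i ↦ ht.inter (hAm i))]
    rw [hν, Measure.sum_apply _ ht]
    refine tsum_congr fun i ↦ ?_
    rw [Measure.restrict_apply ht]
    exact chartVolume_eq_of_subset (ht.inter (hAm i)) (Set.inter_subset_right.trans (hAs i))
      (Set.inter_subset_left.trans hte)
  have hle : riemannianVolume n M ≤ ν := by
    refine iSup_le fun e ↦ Measure.le_iff.2 fun t ht ↦ ?_
    rw [← chartVolume_inter_source e ht,
      ← key e (ht.inter (isOpen_extChartAt_source e).measurableSet) Set.inter_subset_right]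
    exact measure_mono Set.inter_subset_left
  exact (hle s).trans_eq (key c hs h)

lemma riemannianVolume_restrict_source (c : M) :
    (riemannianVolume n M).restrict (extChartAt (𝓡 n) c).source = chartVolume n c := by
  ext s hs
  rw [Measure.restrict_apply hs, ← chartVolume_inter_source c hs]
  exact riemannianVolume_apply_of_subset
    (hs.inter (isOpen_extChartAt_source c).measurableSet) Set.inter_subset_right

variable [IsContMDiffRiemannianBundle (𝓡 n) ∞ (EuclideanSpace ℝ (Fin n))
  (fun x : M ↦ TangentSpace (𝓡 n) x)]

omit [MeasurableSpace M] [BorelSpace M] [SecondCountableTopology M] in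
lemma aemeasurable_volumeDensity (c : M) :
    AEMeasurable (fun y ↦ volumeDensity c y) (volume.restrict (extChartAt (𝓡 n) c).target) :=
  (contDiffOn_volumeDensity c).continuousOn.aemeasurable (isOpen_extChartAt_target c).measurableSet

/-- The integral in a chart of a function that vanishes outside of the chart domain. -/
lemma integral_riemannianVolume_eq {c : M} {F : M → ℝ} (hF : Continuous F)
    (h : ∀ x, x ∉ (extChartAt (𝓡 n) c).source → F x = 0) :
    ∫ x, F x ∂(riemannianVolume n M) =
      ∫ y in (extChartAt (𝓡 n) c).target,
        volumeDensity c y * F ((extChartAt (𝓡 n) c).symm y) := by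
  rw [← setIntegral_eq_integral_of_forall_compl_eq_zero h, riemannianVolume_restrict_source,
    chartVolume, integral_map
      ((aemeasurable_extChartAt_symm c).mono_ac (withDensity_absolutelyContinuous _ _))
      hF.aestronglyMeasurable]
  rw [integral_withDensity_eq_integral_toReal_smul₀ (aemeasurable_volumeDensity c).ennreal_ofReal
    (by simp)]
  simp [volumeDensity, Real.sqrt_nonneg]

/-- The density is positive in each chart. This is what allows continuous functions to be compared
by integrating against bump functions, and makes a bump function nonzero in L². -/
lemma riemannianVolume_isOpenPosMeasure : (riemannianVolume n M).IsOpenPosMeasure := by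
  refine ⟨fun U hU ⟨p, hp⟩ h0 ↦ ?_⟩
  have hV : IsOpen (U ∩ (extChartAt (𝓡 n) p).source) := hU.inter (isOpen_extChartAt_source p)
  have h1 : riemannianVolume n M (U ∩ (extChartAt (𝓡 n) p).source) = 0 :=
    measure_mono_null Set.inter_subset_left h0
  rw [riemannianVolume_apply_of_subset hV.measurableSet Set.inter_subset_right,
    chartVolume_apply p hV.measurableSet] at h1
  set A := (extChartAt (𝓡 n) p).target ∩
    (extChartAt (𝓡 n) p).symm ⁻¹' (U ∩ (extChartAt (𝓡 n) p).source) with hA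
  have hAo : IsOpen A :=
    (continuousOn_extChartAt_symm (I := 𝓡 n) p).isOpen_inter_preimage (isOpen_extChartAt_target p) hV
  have hAne : A.Nonempty := ⟨extChartAt (𝓡 n) p p, mem_extChartAt_target p, by simp [hp]⟩
  rw [lintegral_eq_zero_iff' ((aemeasurable_volumeDensity p).ennreal_ofReal.mono_measure
    (Measure.restrict_mono Set.inter_subset_left le_rfl))] at h1
  have h2 : ∀ᵐ y ∂(volume.restrict A), False := by
    filter_upwards [h1, ae_restrict_mem hAo.measurableSet] with y hy hyA
    simp only [Pi.zero_apply, ENNReal.ofReal_eq_zero] at hy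
    exact absurd (volumeDensity_pos hyA.1) (not_lt.2 hy)
  rw [ae_iff] at h2
  simp only [not_false_eq_true, Set.ofPred_true, Measure.restrict_apply_univ] at h2
  exact (hAo.measure_pos volume hAne).ne' h2

lemma riemannianVolume_isLocallyFiniteMeasure : IsLocallyFiniteMeasure (riemannianVolume n M) := by
  refine ⟨fun p ↦ ?_⟩
  have ho := isOpen_extChartAt_target (I := 𝓡 n) p
  -- The continuous density is integrable on a compact coordinate neighbourhood of p.
  obtain ⟨K, hK, hKp, hKt⟩ := exists_compact_subset ho (mem_extChartAt_target p)
  have hV : IsOpen ((extChartAt (𝓡 n) p).source ∩ extChartAt (𝓡 n) p ⁻¹' interior K) :=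
    (continuousOn_extChartAt (I := 𝓡 n) p).isOpen_inter_preimage (isOpen_extChartAt_source p)
      isOpen_interior
  refine ⟨_, hV.mem_nhds ⟨mem_extChartAt_source p, hKp⟩, ?_⟩
  rw [riemannianVolume_apply_of_subset hV.measurableSet Set.inter_subset_left,
    chartVolume_apply p hV.measurableSet]
  have hint : IntegrableOn (fun y ↦ volumeDensity p y) K :=
    ((contDiffOn_volumeDensity p).continuousOn.mono hKt).integrableOn_compact hK
  refine lt_of_le_of_lt (lintegral_mono_set fun y hy ↦ ?_)
    (hint.hasFiniteIntegral.trans_le' (lintegral_mono fun y ↦ ?_))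
  · have := interior_subset hy.2.2
    rwa [(extChartAt (𝓡 n) p).right_inv hy.1] at this
  · exact Real.ofReal_le_enorm _

end Volume

/-- Continuity only has to be checked on the closed support of the product, which lies in the open
set where `a` is continuous. It serves for expressions that are meaningful in one chart only. -/
lemma continuous_mul_of_tsupport_subset {α : Type*} [TopologicalSpace α] {a u : α → ℝ} {s : Set α}
    (hs : IsOpen s) (ha : ContinuousOn a s) (hu : Continuous u) (h : tsupport u ⊆ s) :
    Continuous fun x ↦ a x * u x :=
  continuous_of_tsupport fun _ hx ↦
    ((ha.continuousAt (hs.mem_nhds (h (closure_mono (Function.support_mul_subset_right a u) hx)))).mul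
      hu.continuousAt)

lemma integrable_of_continuousOn_of_support_subset {E : Type*} [TopologicalSpace E] [T2Space E]
    [MeasurableSpace E] [OpensMeasurableSpace E] {μ : Measure E} [IsFiniteMeasureOnCompacts μ]
    {F : E → ℝ} {K : Set E} (hK : IsCompact K) (hF : ContinuousOn F K)
    (h : Function.support F ⊆ K) : Integrable F μ :=
  (integrableOn_iff_integrable_of_support_subset h).1 (hF.integrableOn_compact' hK hK.measurableSet)

/-! ### The divergence theorem -/

section Divergence

variable [IsManifold (𝓡 n) ∞ M]

omit [IsManifold (𝓡 n) ∞ M] in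
lemma mvfderiv_eq_zero_of_notMem_tsupport {u : M → ℝ} {x : M} (hx : x ∉ tsupport u) :
    mvfderiv (𝓡 n) u x = 0 := by
  have h : u =ᶠ[𝓝 x] fun _ ↦ 0 := notMem_tsupport_iff_eventuallyEq.1 hx
  unfold mvfderiv
  rw [h.mfderiv_eq, mfderiv_const]
  exact ContinuousLinearMap.comp_zero _

lemma continuous_mvfderiv_apply {X : Π x : M, TangentSpace (𝓡 n) x}
    (hX : ContMDiff (𝓡 n) (𝓡 n).tangent ∞ (fun x ↦ (⟨x, X x⟩ : TangentBundle (𝓡 n) M)))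
    {u : M → ℝ} (hu : ContMDiff (𝓡 n) 𝓘(ℝ, ℝ) ∞ u) :
    Continuous fun x ↦ mvfderiv (𝓡 n) u x (X x) := by
  refine continuous_iff_continuousAt.2 fun p ↦ ?_
  have ho := isOpen_extChartAt_target (I := 𝓡 n) p
  have h1 : ContinuousOn (fun y ↦ ∑ i, coordComponent X p i y *
      fderiv ℝ (u ∘ (extChartAt (𝓡 n) p).symm) y (EuclideanSpace.single i (1 : ℝ)))
      (extChartAt (𝓡 n) p).target :=
    continuousOn_finsetSum _ fun i _ ↦ (contDiffOn_coordComponent hX p i).continuousOn.mul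
      (((contDiffOn_comp_symm hu p).continuousOn_fderiv_of_isOpen ho (by simp)).clm_apply
        continuousOn_const)
  refine ((h1.continuousAt (ho.mem_nhds (mem_extChartAt_target p))).comp
    (continuousAt_extChartAt p)).congr ?_
  filter_upwards [extChartAt_source_mem_nhds (I := 𝓡 n) p] with x hx
  have h2 := mvfderiv_eq_sum X ((extChartAt (𝓡 n) p).map_source hx)
    (hu.mdifferentiableAt (by simp))
  rw [(extChartAt (𝓡 n) p).left_inv hx] at h2
  exact h2.symm

/-- A smooth function with values in `[0, 1]`, compactly supported in a given neighbourhood. -/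
lemma exists_isTestFunction [T2Space M] {V : Set M} {x : M} (hV : V ∈ 𝓝 x) :
    ∃ u : M → ℝ, IsTestFunction n V u ∧ (∀ z, 0 ≤ u z) ∧ u x = 1 := by
  obtain ⟨b, -, hb⟩ := (SmoothBumpFunction.nhds_basis_tsupport (I := 𝓡 n) x).mem_iff.1 hV
  exact ⟨b, ⟨b.contMDiff, b.hasCompactSupport, hb⟩, fun z ↦ b.nonneg, b.eq_one⟩

variable [RiemannianBundle (fun x : M ↦ TangentSpace (𝓡 n) x)]

/-- The expression `(1 / √g) ∑ᵢ ∂(√g Xⁱ)/∂yⁱ` of the divergence in the chart around `c`. -/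
def chartDivergence (X : Π x : M, TangentSpace (𝓡 n) x) (c : M)
    (y : EuclideanSpace ℝ (Fin n)) : ℝ :=
  (volumeDensity c y)⁻¹ *
    ∑ i : Fin n, fderiv ℝ (fun y ↦ volumeDensity c y * coordComponent X c i y) y
      (EuclideanSpace.single i (1 : ℝ))

variable [IsContMDiffRiemannianBundle (𝓡 n) ∞ (EuclideanSpace ℝ (Fin n))
  (fun x : M ↦ TangentSpace (𝓡 n) x)]

section Field

variable {X : Π x : M, TangentSpace (𝓡 n) x}
  (hX : ContMDiff (𝓡 n) (𝓡 n).tangent ∞ (fun x ↦ (⟨x, X x⟩ : TangentBundle (𝓡 n) M)))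

include hX

lemma contDiffOn_density_mul_component (c : M) (i : Fin n) :
    ContDiffOn ℝ ∞ (fun y ↦ volumeDensity c y * coordComponent X c i y)
      (extChartAt (𝓡 n) c).target :=
  (contDiffOn_volumeDensity c).mul (contDiffOn_coordComponent hX c i)

lemma continuousOn_chartDivergence (c : M) :
    ContinuousOn (chartDivergence X c) (extChartAt (𝓡 n) c).target := by
  refine ((contDiffOn_volumeDensity c).continuousOn.inv₀
    fun y hy ↦ (volumeDensity_pos hy).ne').mul (continuousOn_finsetSum _ fun i _ ↦ ?_)
  exact ((contDiffOn_density_mul_component hX c i).continuousOn_fderiv_of_isOpen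
    (isOpen_extChartAt_target c) (by simp)).clm_apply continuousOn_const

lemma continuousOn_chartDivergence_comp (c : M) :
    ContinuousOn (fun x ↦ chartDivergence X c (extChartAt (𝓡 n) c x))
      (extChartAt (𝓡 n) c).source :=
  (continuousOn_chartDivergence hX c).comp (continuousOn_extChartAt c)
    fun _ hx ↦ (extChartAt (𝓡 n) c).map_source hx

variable [T2Space M] [SecondCountableTopology M] [MeasurableSpace M] [BorelSpace M]

omit [T2Space M] in
/-- The divergence theorem in a chart. -/
lemma integral_chartDivergence_mul {c : M} {u : M → ℝ}
    (hu : IsTestFunction n (extChartAt (𝓡 n) c).source u) :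
    ∫ x, chartDivergence X c (extChartAt (𝓡 n) c x) * u x ∂(riemannianVolume n M) =
      -∫ x, mvfderiv (𝓡 n) u x (X x) ∂(riemannianVolume n M) := by
  set T := (extChartAt (𝓡 n) c).target with hT
  have hTo : IsOpen T := isOpen_extChartAt_target c
  set K := extChartAt (𝓡 n) c '' tsupport u with hKdef
  have hK : IsCompact K :=
    hu.hasCompactSupport.isCompact.image_of_continuousOn
      ((continuousOn_extChartAt c).mono hu.tsupport_subset)
  have hKT : K ⊆ T := by
    rintro _ ⟨x, hx, rfl⟩
    exact (extChartAt (𝓡 n) c).map_source (hu.tsupport_subset hx)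
  -- Extension by zero of u in coordinates. It is smooth on all of ℝⁿ because its support lies in
  -- the compact set `K` inside `T`, so integration by parts takes place on the whole space.
  set g : EuclideanSpace ℝ (Fin n) → ℝ := T.indicator (u ∘ (extChartAt (𝓡 n) c).symm) with hg
  have hgT : ∀ y ∈ T, g =ᶠ[𝓝 y] u ∘ (extChartAt (𝓡 n) c).symm := fun y hy ↦ by
    filter_upwards [hTo.mem_nhds hy] with z hz using Set.indicator_of_mem hz _
  have hg0 : ∀ y ∉ K, g y = 0 := by
    intro y hy
    by_cases hyT : y ∈ T
    · rw [hg, Set.indicator_of_mem hyT, Function.comp_apply]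
      by_contra h
      exact hy ⟨_, subset_tsupport _ h, (extChartAt (𝓡 n) c).right_inv hyT⟩
    · exact Set.indicator_of_notMem hyT _
  have hgK : ∀ y ∉ K, g =ᶠ[𝓝 y] fun _ ↦ 0 := fun y hy ↦ by
    filter_upwards [hK.isClosed.isOpen_compl.mem_nhds hy] with z hz using hg0 z hz
  have hgs : ContDiff ℝ ∞ g := contDiff_iff_contDiffAt.2 fun y ↦ by
    by_cases hy : y ∈ T
    · exact ((contDiffOn_comp_symm hu.smooth c).contDiffAt (hTo.mem_nhds hy)).congr_of_eventuallyEq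
        (hgT y hy)
    · exact contDiffAt_const.congr_of_eventuallyEq (hgK y fun h ↦ hy (hKT h))
  have hdg0 : ∀ y ∉ K, fderiv ℝ g y = 0 := fun y hy ↦ by
    rw [(hgK y hy).fderiv_eq]; simp
  have htg : tsupport g ⊆ K :=
    closure_minimal (fun y hy ↦ by_contra fun h ↦ hy (hg0 y h)) hK.isClosed
  set f : Fin n → EuclideanSpace ℝ (Fin n) → ℝ :=
    fun i y ↦ volumeDensity c y * coordComponent X c i y with hf
  have hfs : ∀ i, ContDiffOn ℝ ∞ (f i) T := contDiffOn_density_mul_component hX c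
  have hfd : ∀ i, ContinuousOn (fun y ↦ fderiv ℝ (f i) y (EuclideanSpace.single i (1 : ℝ))) T :=
    fun i ↦ ((hfs i).continuousOn_fderiv_of_isOpen hTo (by simp)).clm_apply continuousOn_const
  have hgd : ∀ i, Continuous (fun y ↦ fderiv ℝ g y (EuclideanSpace.single i (1 : ℝ))) :=
    fun i ↦ (hgs.continuous_fderiv (by simp)).clm_apply continuous_const
  have hint1 : ∀ i, Integrable
      (fun y ↦ fderiv ℝ (f i) y (EuclideanSpace.single i (1 : ℝ)) * g y) := fun i ↦
    integrable_of_continuousOn_of_support_subset hK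
      (((hfd i).mono hKT).mul hgs.continuous.continuousOn)
      fun y hy ↦ by_contra fun h ↦ hy (by simp [hg0 y h])
  have hint2 : ∀ i, Integrable
      (fun y ↦ f i y * fderiv ℝ g y (EuclideanSpace.single i (1 : ℝ))) := fun i ↦
    integrable_of_continuousOn_of_support_subset hK
      (((hfs i).continuousOn.mono hKT).mul (hgd i).continuousOn)
      fun y hy ↦ by_contra fun h ↦ hy (by simp [hdg0 y h])
  have hint3 : ∀ i, Integrable (fun y ↦ f i y * g y) := fun i ↦
    integrable_of_continuousOn_of_support_subset hK
      (((hfs i).continuousOn.mono hKT).mul hgs.continuous.continuousOn)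
      fun y hy ↦ by_contra fun h ↦ hy (by simp [hg0 y h])
  -- The function `f i` is controlled only on `T`; differentiability on the support of `g` is enough
  -- for integration by parts.
  have hparts : ∀ i, ∫ y, f i y * fderiv ℝ g y (EuclideanSpace.single i (1 : ℝ)) =
      -∫ y, fderiv ℝ (f i) y (EuclideanSpace.single i (1 : ℝ)) * g y := fun i ↦
    integral_mul_fderiv_eq_neg_fderiv_mul_of_integrable (hint1 i) (hint2 i) (hint3 i)
      (fun y hy ↦ ((hfs i).contDiffAt (hTo.mem_nhds (hKT (htg hy)))).differentiableAt (by simp))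
      (fun y _ ↦ hgs.differentiable (by simp) y)
  have hleft : ∫ x, chartDivergence X c (extChartAt (𝓡 n) c x) * u x ∂(riemannianVolume n M) =
      ∑ i, ∫ y, fderiv ℝ (f i) y (EuclideanSpace.single i (1 : ℝ)) * g y := by
    rw [integral_riemannianVolume_eq (c := c)
      (continuous_mul_of_tsupport_subset (isOpen_extChartAt_source c)
        (continuousOn_chartDivergence_comp hX c) hu.smooth.continuous hu.tsupport_subset)
      (fun x hx ↦ by
        rw [image_eq_zero_of_notMem_tsupport fun h ↦ hx (hu.tsupport_subset h), mul_zero]),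
      ← integral_finsetSum _ fun i _ ↦ hint1 i]
    refine (setIntegral_congr_fun hTo.measurableSet fun y hy ↦ ?_).trans
      (setIntegral_eq_integral_of_forall_compl_eq_zero (s := T)
        fun y hy ↦ by simp [hg0 y fun h ↦ hy (hKT h)])
    -- The volume density √g cancels the prefactor 1/√g of the divergence.
    simp only [(extChartAt (𝓡 n) c).right_inv hy, chartDivergence, hg,
      Set.indicator_of_mem hy, Function.comp_apply, ← Finset.sum_mul, ← mul_assoc,
      mul_inv_cancel₀ (volumeDensity_pos hy).ne', one_mul, hf]
  have hright : ∫ x, mvfderiv (𝓡 n) u x (X x) ∂(riemannianVolume n M) =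
      ∑ i, ∫ y, f i y * fderiv ℝ g y (EuclideanSpace.single i (1 : ℝ)) := by
    rw [integral_riemannianVolume_eq (c := c) (continuous_mvfderiv_apply hX hu.smooth)
      (fun x hx ↦ by
        rw [mvfderiv_eq_zero_of_notMem_tsupport fun h ↦ hx (hu.tsupport_subset h)]; rfl),
      ← integral_finsetSum _ fun i _ ↦ hint2 i]
    refine (setIntegral_congr_fun hTo.measurableSet fun y hy ↦ ?_).trans
      (setIntegral_eq_integral_of_forall_compl_eq_zero (s := T)
        fun y hy ↦ by simp [hdg0 y fun h ↦ hy (hKT h)])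
    simp only [mvfderiv_eq_sum X hy (hu.smooth.mdifferentiableAt (by simp)), Finset.mul_sum,
      (hgT y hy).fderiv_eq, hf, mul_assoc]
  rw [hleft, hright, ← Finset.sum_neg_distrib]
  exact Finset.sum_congr rfl fun i _ ↦ by rw [hparts i, neg_neg]

/-- No computation in coordinates is needed: for u supported in both chart domains, both expressions
integrate against u to -∫ du(X). A strict inequality at x would persist nearby by continuity, and a
bump function there would separate the two integrals. Exchanging the charts gives equality. -/
lemma chartDivergence_le {c c' x : M} (hx : x ∈ (extChartAt (𝓡 n) c).source)
    (hx' : x ∈ (extChartAt (𝓡 n) c').source) :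
    chartDivergence X c (extChartAt (𝓡 n) c x) ≤ chartDivergence X c' (extChartAt (𝓡 n) c' x) := by
  have := riemannianVolume_isOpenPosMeasure (n := n) (M := M)
  have := riemannianVolume_isLocallyFiniteMeasure (n := n) (M := M)
  by_contra! hlt
  have hc := (continuousOn_chartDivergence_comp hX c).continuousAt
    (extChartAt_source_mem_nhds' hx)
  have hc' := (continuousOn_chartDivergence_comp hX c').continuousAt
    (extChartAt_source_mem_nhds' hx')
  obtain ⟨u, hu, hu0, hux⟩ := exists_isTestFunction (n := n)
    (inter_mem (inter_mem (extChartAt_source_mem_nhds' hx) (extChartAt_source_mem_nhds' hx'))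
      (hc'.eventually_lt hc hlt))
  have hu1 : IsTestFunction n (extChartAt (𝓡 n) c).source u :=
    ⟨hu.smooth, hu.hasCompactSupport, hu.tsupport_subset.trans fun _ h ↦ h.1.1⟩
  have hu2 : IsTestFunction n (extChartAt (𝓡 n) c').source u :=
    ⟨hu.smooth, hu.hasCompactSupport, hu.tsupport_subset.trans fun _ h ↦ h.1.2⟩
  have hF1 := continuous_mul_of_tsupport_subset (isOpen_extChartAt_source c)
    (continuousOn_chartDivergence_comp hX c) hu.smooth.continuous hu1.tsupport_subset
  have hF2 := continuous_mul_of_tsupport_subset (isOpen_extChartAt_source c')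
    (continuousOn_chartDivergence_comp hX c') hu.smooth.continuous hu2.tsupport_subset
  have hpos := (hF1.sub hF2).integral_pos_of_hasCompactSupport_nonneg_nonzero
    (μ := riemannianVolume n M) (x := x)
    (hu.hasCompactSupport.mul_left.sub hu.hasCompactSupport.mul_left)
    (fun z ↦ by
      by_cases hz : z ∈ tsupport u
      · have := (hu.tsupport_subset hz).2
        simp only [Pi.zero_apply, Pi.sub_apply, ← sub_mul]
        exact mul_nonneg (sub_nonneg.2 (le_of_lt this)) (hu0 z)
      · simp [image_eq_zero_of_notMem_tsupport hz])
    (by simpa [hux, sub_eq_zero] using hlt.ne')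
  simp only [Pi.sub_apply] at hpos
  rw [integral_sub (hF1.integrable_of_hasCompactSupport hu.hasCompactSupport.mul_left)
    (hF2.integrable_of_hasCompactSupport hu.hasCompactSupport.mul_left),
    integral_chartDivergence_mul hX hu1, integral_chartDivergence_mul hX hu2, sub_self] at hpos
  exact lt_irrefl _ hpos

lemma divergence_eq_chartDivergence {c x : M} (hx : x ∈ (extChartAt (𝓡 n) c).source) :
    divergence X x = chartDivergence X c (extChartAt (𝓡 n) c x) :=
  le_antisymm (chartDivergence_le hX (mem_extChartAt_source x) hx)
    (chartDivergence_le hX hx (mem_extChartAt_source x))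

lemma continuous_divergence : Continuous (divergence X) := by
  refine continuous_iff_continuousAt.2 fun p ↦ ?_
  refine ((continuousOn_chartDivergence_comp hX p).continuousAt
    (extChartAt_source_mem_nhds p)).congr ?_
  filter_upwards [extChartAt_source_mem_nhds (I := 𝓡 n) p] with x hx
  exact (divergence_eq_chartDivergence hX hx).symm

lemma integral_divergence_mul_of_subset_source {c : M} {u : M → ℝ}
    (hu : IsTestFunction n (extChartAt (𝓡 n) c).source u) :
    ∫ x, divergence X x * u x ∂(riemannianVolume n M) =
      -∫ x, mvfderiv (𝓡 n) u x (X x) ∂(riemannianVolume n M) := by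
  rw [← integral_chartDivergence_mul hX hu]
  refine integral_congr_ae (.of_forall fun x ↦ ?_)
  by_cases hx : x ∈ tsupport u
  · simp only [divergence_eq_chartDivergence hX (hu.tsupport_subset hx)]
  · simp [image_eq_zero_of_notMem_tsupport hx]

lemma integrable_mvfderiv_apply {u : M → ℝ} (hu : ContMDiff (𝓡 n) 𝓘(ℝ, ℝ) ∞ u)
    (hc : HasCompactSupport u) :
    Integrable (fun x ↦ mvfderiv (𝓡 n) u x (X x)) (riemannianVolume n M) := by
  have := riemannianVolume_isLocallyFiniteMeasure (n := n) (M := M)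
  refine (continuous_mvfderiv_apply hX hu).integrable_of_hasCompactSupport
    (HasCompactSupport.intro hc fun x hx ↦ ?_)
  rw [mvfderiv_eq_zero_of_notMem_tsupport hx]
  rfl

lemma integrable_divergence_mul {u : M → ℝ} (hu : Continuous u) (hc : HasCompactSupport u) :
    Integrable (fun x ↦ divergence X x * u x) (riemannianVolume n M) := by
  have := riemannianVolume_isLocallyFiniteMeasure (n := n) (M := M)
  exact ((continuous_divergence hX).mul hu).integrable_of_hasCompactSupport hc.mul_left

/-- The divergence theorem. -/
theorem integral_divergence_mul {u : M → ℝ} (hu : ContMDiff (𝓡 n) 𝓘(ℝ, ℝ) ∞ u)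
    (hc : HasCompactSupport u) :
    ∫ x, divergence X x * u x ∂(riemannianVolume n M) =
      -∫ x, mvfderiv (𝓡 n) u x (X x) ∂(riemannianVolume n M) := by
  have : LocallyCompactSpace M := ChartedSpace.locallyCompactSpace (EuclideanSpace ℝ (Fin n)) M
  obtain ⟨ρ, hρ⟩ := SmoothPartitionOfUnity.exists_isSubordinate (𝓡 n) isClosed_univ
    (fun c : M ↦ (extChartAt (𝓡 n) c).source) (fun c ↦ isOpen_extChartAt_source c)
    (fun x _ ↦ Set.mem_iUnion.2 ⟨x, mem_extChartAt_source x⟩)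
  -- Only finitely many of the supports meet the compact support of u, so u = ∑ ρ_c u reduces to a
  -- finite sum.
  have hfin := ρ.locallyFinite.finite_nonempty_inter_compact hc.isCompact
  have hsum : u = ∑ c ∈ hfin.toFinset, fun x ↦ ρ c x * u x := by
    ext x
    rw [Finset.sum_apply, ← Finset.sum_mul]
    by_cases hx : u x = 0
    · simp [hx]
    · have h1 := ρ.sum_eq_one (Set.mem_univ x)
      rw [finsum_eq_sum_of_support_subset (s := hfin.toFinset)] at h1
      · rw [h1, one_mul]
      · intro c hcx
        simp only [Set.Finite.coe_toFinset, Set.mem_ofPred_eq]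
        exact ⟨x, hcx, subset_tsupport _ hx⟩
  -- Smoothness and compact support are carried through the induction because additivity of the
  -- integrals needs integrability of each summand.
  suffices h : ContMDiff (𝓡 n) 𝓘(ℝ, ℝ) ∞ u ∧ HasCompactSupport u ∧
      ∫ x, divergence X x * u x ∂(riemannianVolume n M) =
        -∫ x, mvfderiv (𝓡 n) u x (X x) ∂(riemannianVolume n M) from h.2.2
  rw [hsum]
  refine Finset.sum_induction _ (fun u : M → ℝ ↦ ContMDiff (𝓡 n) 𝓘(ℝ, ℝ) ∞ u ∧
      HasCompactSupport u ∧ ∫ x, divergence X x * u x ∂(riemannianVolume n M) =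
        -∫ x, mvfderiv (𝓡 n) u x (X x) ∂(riemannianVolume n M)) ?_ ?_ ?_
  · rintro v w ⟨hv, hvc, hvi⟩ ⟨hw, hwc, hwi⟩
    refine ⟨hv.add hw, hvc.add hwc, ?_⟩
    have hd : ∀ x, mvfderiv (𝓡 n) (v + w) x (X x) =
        mvfderiv (𝓡 n) v x (X x) + mvfderiv (𝓡 n) w x (X x) := fun x ↦ by
      rw [mvfderiv_add (hv.mdifferentiableAt (by simp)) (hw.mdifferentiableAt (by simp))]
      rfl
    simp only [hd, Pi.add_apply, mul_add]
    rw [integral_add (integrable_divergence_mul hX hv.continuous hvc)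
      (integrable_divergence_mul hX hw.continuous hwc),
      integral_add (integrable_mvfderiv_apply hX hv hvc) (integrable_mvfderiv_apply hX hw hwc),
      hvi, hwi, neg_add]
  · refine ⟨contMDiff_const, HasCompactSupport.zero, ?_⟩
    simp
  · intro c _
    have ht : IsTestFunction n (extChartAt (𝓡 n) c).source fun x ↦ ρ c x * u x :=
      ⟨(ρ c).contMDiff.mul hu, hc.mul_left,
        (closure_mono (Function.support_mul_subset_left _ _)).trans (hρ c)⟩
    exact ⟨ht.smooth, ht.hasCompactSupport, integral_divergence_mul_of_subset_source hX ht⟩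

end Field

end Divergence

/-- The integral of the square is the squared norm in L², and the norm is continuous. -/
lemma tendsto_integral_sq_of_tendsto_eLpNorm {α : Type*} [MeasurableSpace α] {μ : Measure α}
    {φ : ℕ → α → ℝ} {f : α → ℝ} (hφ : ∀ k, MemLp (φ k) 2 μ) (hf : MemLp f 2 μ)
    (h : Tendsto (fun k ↦ eLpNorm (φ k - f) 2 μ) atTop (𝓝 0)) :
    Tendsto (fun k ↦ ∫ x, φ k x ^ 2 ∂μ) atTop (𝓝 (∫ x, f x ^ 2 ∂μ)) := by
  have key : ∀ {g : α → ℝ} (hg : MemLp g 2 μ), ∫ x, g x ^ 2 ∂μ = ‖hg.toLp g‖ ^ 2 := by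
    intro g hg
    rw [← real_inner_self_eq_norm_sq, L2.inner_def]
    refine integral_congr_ae ?_
    filter_upwards [hg.coeFn_toLp] with x hx
    simp [hx, sq]
  simp only [key (hφ _), key hf]
  exact (((Lp.tendsto_Lp_iff_tendsto_eLpNorm'' φ hφ f hf).2 h).norm).pow 2

/-! ### The gradient and the inequality for test functions -/

section Gradient

variable [RiemannianBundle (fun x : M ↦ TangentSpace (𝓡 n) x)]

lemma inner_riemannianGradient (u : M → ℝ) (x : M) (v : TangentSpace (𝓡 n) x) :
    inner ℝ (riemannianGradient n u x) v = mvfderiv (𝓡 n) u x v := by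
  have : FiniteDimensional ℝ (TangentSpace (𝓡 n) x) :=
    inferInstanceAs (FiniteDimensional ℝ (EuclideanSpace ℝ (Fin n)))
  have : CompleteSpace (TangentSpace (𝓡 n) x) := FiniteDimensional.complete ℝ _
  exact InnerProductSpace.toDual_symm_apply

lemma riemannianGradient_eq_zero {u : M → ℝ} {x : M} (h : mvfderiv (𝓡 n) u x = 0) :
    riemannianGradient n u x = 0 := by
  rw [← inner_self_eq_zero (𝕜 := ℝ), inner_riemannianGradient, h]
  rfl

variable [IsManifold (𝓡 n) ∞ M]

/-- The expression `∑ᵢⱼ gⁱʲ ∂ᵢu ∂ⱼu` of `|∇u|²` in a chart. -/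
lemma norm_riemannianGradient_sq {u : M → ℝ} {c : M} {y : EuclideanSpace ℝ (Fin n)}
    (hy : y ∈ (extChartAt (𝓡 n) c).target)
    (hu : MDifferentiableAt (𝓡 n) 𝓘(ℝ, ℝ) u ((extChartAt (𝓡 n) c).symm y)) :
    ‖riemannianGradient n u ((extChartAt (𝓡 n) c).symm y)‖ ^ 2 =
      Matrix.vecMul (fun i ↦ fderiv ℝ (u ∘ (extChartAt (𝓡 n) c).symm) y
        (EuclideanSpace.single i (1 : ℝ))) (metricMatrix c y)⁻¹ ⬝ᵥ
      fun i ↦ fderiv ℝ (u ∘ (extChartAt (𝓡 n) c).symm) y (EuclideanSpace.single i (1 : ℝ)) := by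
  set b : Fin n → ℝ := fun i ↦ fderiv ℝ (u ∘ (extChartAt (𝓡 n) c).symm) y
    (EuclideanSpace.single i (1 : ℝ)) with hb
  set a : Fin n → ℝ := fun i ↦ coordComponent (riemannianGradient n u) c i y with ha
  -- Pairing the gradient with the coordinate fields gives a linear system for its components;
  -- inverting g solves it, and |∇u|² = du(∇u) is then the sum of the aᵢbᵢ.
  have h1 : Matrix.vecMul a (metricMatrix c y) = b := by
    ext j
    refine Eq.trans ?_ (mvfderiv_coordField hy hu j)
    rw [← inner_riemannianGradient]
    conv_rhs => rw [← sum_coordComponent_smul (riemannianGradient n u) hy]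
    rw [sum_inner]
    simp only [Matrix.vecMul, dotProduct]
    refine Finset.sum_congr rfl fun i _ ↦ ?_
    exact (real_inner_smul_left
      (F := TangentSpace (𝓡 n) ((extChartAt (𝓡 n) c).symm y)) _ _ _).symm
  have h2 : Matrix.vecMul b (metricMatrix c y)⁻¹ = a := by
    rw [← h1, Matrix.vecMul_vecMul, Matrix.mul_nonsing_inv _
      (isUnit_iff_ne_zero.2 (posDef_metricMatrix hy).det_pos.ne'), Matrix.vecMul_one]
  rw [h2, ← real_inner_self_eq_norm_sq, inner_riemannianGradient, mvfderiv_eq_sum _ hy hu]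
  rfl

variable [IsContMDiffRiemannianBundle (𝓡 n) ∞ (EuclideanSpace ℝ (Fin n))
  (fun x : M ↦ TangentSpace (𝓡 n) x)]

lemma continuousOn_metricMatrix_inv (c : M) :
    ContinuousOn (fun y ↦ (metricMatrix c y)⁻¹) (extChartAt (𝓡 n) c).target := by
  have h : ContinuousOn (fun y ↦ metricMatrix c y) (extChartAt (𝓡 n) c).target :=
    continuousOn_pi.2 fun i ↦ continuousOn_pi.2 fun j ↦ (contDiffOn_metricMatrix c i j).continuousOn
  simp only [Matrix.inv_def, Ring.inverse_eq_inv']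
  exact ((contDiffOn_det (contDiffOn_metricMatrix c)).continuousOn.inv₀
    fun y hy ↦ (posDef_metricMatrix hy).det_pos.ne').smul
      ((continuous_id.matrix_adjugate).comp_continuousOn h)

lemma continuous_norm_riemannianGradient_sq {u : M → ℝ}
    (hu : ContMDiff (𝓡 n) 𝓘(ℝ, ℝ) ∞ u) :
    Continuous fun x ↦ ‖riemannianGradient n u x‖ ^ 2 := by
  refine continuous_iff_continuousAt.2 fun p ↦ ?_
  have ho := isOpen_extChartAt_target (I := 𝓡 n) p
  have h0 : ∀ i, ContinuousOn (fun y ↦ fderiv ℝ (u ∘ (extChartAt (𝓡 n) p).symm) y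
      (EuclideanSpace.single i (1 : ℝ))) (extChartAt (𝓡 n) p).target := fun i ↦
    ((contDiffOn_comp_symm hu p).continuousOn_fderiv_of_isOpen ho (by simp)).clm_apply
      continuousOn_const
  have h1 : ContinuousOn (fun y ↦ Matrix.vecMul (fun i ↦ fderiv ℝ
        (u ∘ (extChartAt (𝓡 n) p).symm) y (EuclideanSpace.single i (1 : ℝ))) (metricMatrix p y)⁻¹ ⬝ᵥ
      fun i ↦ fderiv ℝ (u ∘ (extChartAt (𝓡 n) p).symm) y (EuclideanSpace.single i (1 : ℝ)))
      (extChartAt (𝓡 n) p).target := by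
    simp only [Matrix.vecMul, dotProduct]
    refine continuousOn_finsetSum _ fun j _ ↦ .mul ?_ (h0 j)
    refine continuousOn_finsetSum _ fun i _ ↦ (h0 i).mul ?_
    exact continuousOn_pi.1 (continuousOn_pi.1 (continuousOn_metricMatrix_inv p) i) j
  refine ((h1.continuousAt (ho.mem_nhds (mem_extChartAt_target p))).comp
    (continuousAt_extChartAt p)).congr ?_
  filter_upwards [extChartAt_source_mem_nhds (I := 𝓡 n) p] with x hx
  have h2 := norm_riemannianGradient_sq ((extChartAt (𝓡 n) p).map_source hx)
    (hu.mdifferentiableAt (by simp))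
  rw [(extChartAt (𝓡 n) p).left_inv hx] at h2
  exact h2.symm

variable [T2Space M] [SecondCountableTopology M] [MeasurableSpace M] [BorelSpace M]

lemma IsTestFunction.integrable_sq {Ω : Set M} {φ : M → ℝ} (hφ : IsTestFunction n Ω φ) :
    Integrable (fun x ↦ φ x ^ 2) (riemannianVolume n M) := by
  have := riemannianVolume_isLocallyFiniteMeasure (n := n) (M := M)
  have hc : Continuous fun x ↦ φ x ^ 2 := hφ.smooth.continuous.pow 2
  exact hc.integrable_of_hasCompactSupport
    (HasCompactSupport.intro hφ.hasCompactSupport fun x hx ↦ by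
      simp [image_eq_zero_of_notMem_tsupport hx])

omit [T2Space M] in
lemma IsTestFunction.memLp {Ω : Set M} {φ : M → ℝ} (hφ : IsTestFunction n Ω φ) :
    MemLp φ 2 ((riemannianVolume n M).restrict Ω) := by
  have := riemannianVolume_isLocallyFiniteMeasure (n := n) (M := M)
  exact (hφ.smooth.continuous.memLp_of_hasCompactSupport hφ.hasCompactSupport).restrict Ω

lemma IsTestFunction.integrable_norm_gradient_sq {Ω : Set M} {φ : M → ℝ}
    (hφ : IsTestFunction n Ω φ) :
    Integrable (fun x ↦ ‖riemannianGradient n φ x‖ ^ 2) (riemannianVolume n M) := by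
  have := riemannianVolume_isLocallyFiniteMeasure (n := n) (M := M)
  refine (continuous_norm_riemannianGradient_sq hφ.smooth).integrable_of_hasCompactSupport
    (HasCompactSupport.intro hφ.hasCompactSupport fun x hx ↦ ?_)
  simp [riemannianGradient_eq_zero (mvfderiv_eq_zero_of_notMem_tsupport hx)]

omit [IsManifold (𝓡 n) ∞ M] [IsContMDiffRiemannianBundle (𝓡 n) ∞ (EuclideanSpace ℝ (Fin n))
  (fun x : M ↦ TangentSpace (𝓡 n) x)] [T2Space M] [SecondCountableTopology M] [BorelSpace M] in
lemma IsTestFunction.gradientIntegral_eq {Ω : Set M} {φ : M → ℝ} (hφ : IsTestFunction n Ω φ) :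
    gradientIntegral n Ω φ = ∫ x, ‖riemannianGradient n φ x‖ ^ 2 ∂(riemannianVolume n M) :=
  setIntegral_eq_integral_of_forall_compl_eq_zero fun x hx ↦ by
    simp [riemannianGradient_eq_zero
      (mvfderiv_eq_zero_of_notMem_tsupport fun h ↦ hx (hφ.tsupport_subset h))]

omit [IsManifold (𝓡 n) ∞ M] [IsContMDiffRiemannianBundle (𝓡 n) ∞ (EuclideanSpace ℝ (Fin n))
  (fun x : M ↦ TangentSpace (𝓡 n) x)] [T2Space M] [SecondCountableTopology M] [BorelSpace M] in
lemma IsTestFunction.setIntegral_sq_eq {Ω : Set M} {φ : M → ℝ} (hφ : IsTestFunction n Ω φ) :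
    ∫ x in Ω, φ x ^ 2 ∂(riemannianVolume n M) = ∫ x, φ x ^ 2 ∂(riemannianVolume n M) :=
  setIntegral_eq_integral_of_forall_compl_eq_zero fun x hx ↦ by
    simp [image_eq_zero_of_notMem_tsupport fun h ↦ hx (hφ.tsupport_subset h)]

/-- This is the divergence theorem for φ², followed by pointwise Cauchy–Schwarz and Young. The form
without division by B remains valid for B = 0, and it is used to exclude that case. -/
lemma IsTestFunction.sq_mul_integral_sq_le {Ω : Set M} {X : Π x : M, TangentSpace (𝓡 n) x}
    (hX : ContMDiff (𝓡 n) (𝓡 n).tangent ∞ (fun x ↦ (⟨x, X x⟩ : TangentBundle (𝓡 n) M)))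
    {h B : ℝ} (hh : 0 < h) (hdiv : ∀ x ∈ Ω, h ≤ divergence X x) (hB : ∀ x ∈ Ω, ‖X x‖ ≤ B)
    {φ : M → ℝ} (hφ : IsTestFunction n Ω φ) :
    h ^ 2 * ∫ x in Ω, φ x ^ 2 ∂(riemannianVolume n M) ≤ (2 * B) ^ 2 * gradientIntegral n Ω φ := by
  rw [hφ.setIntegral_sq_eq, hφ.gradientIntegral_eq]
  have hsm : ContMDiff (𝓡 n) 𝓘(ℝ, ℝ) ∞ (φ * φ) := hφ.smooth.mul hφ.smooth
  have hcs : HasCompactSupport (φ * φ) := hφ.hasCompactSupport.mul_left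
  have h1 : h * ∫ x, φ x ^ 2 ∂(riemannianVolume n M) ≤
      ∫ x, divergence X x * (φ * φ) x ∂(riemannianVolume n M) := by
    rw [← integral_const_mul]
    refine integral_mono (hφ.integrable_sq.const_mul h)
      (integrable_divergence_mul hX hsm.continuous hcs) fun x ↦ ?_
    by_cases hx : x ∈ Ω
    · simpa [sq] using mul_le_mul_of_nonneg_right (hdiv x hx) (mul_self_nonneg (φ x))
    · simp [image_eq_zero_of_notMem_tsupport fun h ↦ hx (hφ.tsupport_subset h)]
  -- The weights come from 2|φ|Bg ≤ (h/2)φ² + (2B²/h)g² with g = |∇φ|, the difference being a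
  -- perfect square over 2h. The coefficient h/2 leaves half of h ∫ φ² after absorption, which
  -- yields the sharp constant of this argument.
  have h2 : -∫ x, mvfderiv (𝓡 n) (φ * φ) x (X x) ∂(riemannianVolume n M) ≤
      h / 2 * ∫ x, φ x ^ 2 ∂(riemannianVolume n M) +
        2 * B ^ 2 / h * ∫ x, ‖riemannianGradient n φ x‖ ^ 2 ∂(riemannianVolume n M) := by
    rw [← integral_neg, ← integral_const_mul, ← integral_const_mul, ← integral_add
      (hφ.integrable_sq.const_mul _) (hφ.integrable_norm_gradient_sq.const_mul _)]
    refine integral_mono (integrable_mvfderiv_apply hX hsm hcs).neg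
      ((hφ.integrable_sq.const_mul _).add (hφ.integrable_norm_gradient_sq.const_mul _))
      fun x ↦ ?_
    have hd : MDifferentiableAt (𝓡 n) 𝓘(ℝ, ℝ) φ x := hφ.smooth.mdifferentiableAt (by simp)
    have hder : mvfderiv (𝓡 n) (φ * φ) x (X x) = 2 * (φ x * mvfderiv (𝓡 n) φ x (X x)) := by
      rw [mvfderiv_mul hd hd, two_mul]
      rfl
    simp only [hder, ← inner_riemannianGradient]
    by_cases hx : x ∈ Ω
    · have hcs := (abs_real_inner_le_norm (riemannianGradient n φ x) (X x)).trans
        (mul_le_mul_of_nonneg_left (hB x hx) (norm_nonneg _))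
      set s := inner ℝ (riemannianGradient n φ x) (X x)
      set g := ‖riemannianGradient n φ x‖
      have h3 : -(2 * (φ x * s)) ≤ 2 * (|φ x| * (g * B)) := by
        have := mul_le_mul_of_nonneg_left hcs (abs_nonneg (φ x))
        rw [← abs_mul] at this
        linarith [neg_abs_le (φ x * s)]
      have h4 : h / 2 * φ x ^ 2 + 2 * B ^ 2 / h * g ^ 2 - 2 * (|φ x| * (g * B)) =
          (h * |φ x| - 2 * B * g) ^ 2 / (2 * h) := by
        rw [← sq_abs (φ x)]
        field_simp
        ring
      have h5 : 0 ≤ (h * |φ x| - 2 * B * g) ^ 2 / (2 * h) := by positivity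
      linarith
    · rw [image_eq_zero_of_notMem_tsupport fun h ↦ hx (hφ.tsupport_subset h)]
      have : 0 ≤ 2 * B ^ 2 / h * ‖riemannianGradient n φ x‖ ^ 2 := by positivity
      simpa using this
  rw [integral_divergence_mul hX hsm hcs] at h1
  have h6 := h1.trans h2
  have h7 : h * (h / 2 * ∫ x, φ x ^ 2 ∂(riemannianVolume n M)) ≤
      h * (2 * B ^ 2 / h * ∫ x, ‖riemannianGradient n φ x‖ ^ 2 ∂(riemannianVolume n M)) :=
    mul_le_mul_of_nonneg_left (by linarith) hh.le
  rw [← mul_assoc h (2 * B ^ 2 / h), mul_div_cancel₀ _ hh.ne'] at h7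
  linarith

omit [IsManifold (𝓡 n) ∞ M] [IsContMDiffRiemannianBundle (𝓡 n) ∞ (EuclideanSpace ℝ (Fin n))
  (fun x : M ↦ TangentSpace (𝓡 n) x)] [T2Space M] [SecondCountableTopology M] [BorelSpace M] in
lemma sobolevNormSq_zero (Ω : Set M) : sobolevNormSq n Ω (0 : M → ℝ) = 0 := by
  simp [sobolevNormSq, gradientIntegral, riemannianGradient_eq_zero (n := n)
    (mvfderiv_zero (I := 𝓡 n) (M := M) (F := ℝ))]

omit [T2Space M] in
-- The constant sequence represents φ in the completion; this supplies an admissible function for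
-- the infimum.
lemma IsTestFunction.hasDirichletEnergy {Ω : Set M} {φ : M → ℝ} (hφ : IsTestFunction n Ω φ) :
    HasDirichletEnergy n Ω φ (gradientIntegral n Ω φ) :=
  ⟨hφ.memLp, fun _ ↦ φ, fun _ ↦ hφ,
    fun ε hε ↦ ⟨0, fun _ _ _ _ ↦ by simpa [sub_self, sobolevNormSq_zero] using hε⟩,
    by simp, tendsto_const_nhds⟩

end Gradient

end RiemannianEigenvalue

end

/-! ### The bound on the completion -/

theorem lemma2p1 {n : ℕ} {M : Type*} [TopologicalSpace M] [T2Space M] [SecondCountableTopology M]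
    [ChartedSpace (EuclideanSpace ℝ (Fin n)) M] [IsManifold (𝓡 n) ∞ M]
    [RiemannianBundle (fun x : M ↦ TangentSpace (𝓡 n) x)]
    [IsContMDiffRiemannianBundle (𝓡 n) ∞ (EuclideanSpace ℝ (Fin n))
      (fun x : M ↦ TangentSpace (𝓡 n) x)]
    [MeasurableSpace M] [BorelSpace M]
    (Ω : Set M) (hΩ_open : IsOpen Ω) (hΩ_conn : IsConnected Ω) (hΩ_cpt : IsCompact (closure Ω))
    (X : Π x : M, TangentSpace (𝓡 n) x)
    (hX : ContMDiff (𝓡 n) (𝓡 n).tangent ∞ (fun x ↦ (⟨x, X x⟩ : TangentBundle (𝓡 n) M)))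
    (hX_bdd : BddAbove (Set.range fun x : Ω ↦ ‖X x‖))
    (hX_div : 0 < ⨅ x : Ω, RiemannianEigenvalue.divergence X x) :
    ((⨅ x : Ω, RiemannianEigenvalue.divergence X x) / (2 * ⨆ x : Ω, ‖X x‖)) ^ 2
        ≤ RiemannianEigenvalue.firstEigenvalue n Ω ∧
      0 < ((⨅ x : Ω, RiemannianEigenvalue.divergence X x) / (2 * ⨆ x : Ω, ‖X x‖)) ^ 2 := by
  have hne : Ω.Nonempty := hΩ_conn.nonempty
  set h : ℝ := ⨅ x : Ω, RiemannianEigenvalue.divergence X x with hh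
  set B : ℝ := ⨆ x : Ω, ‖X x‖ with hB
  -- An infimum of reals that is not bounded below is 0 by convention, which the positivity of `h`
  -- excludes.
  have hbdd : BddBelow (Set.range fun x : Ω ↦ RiemannianEigenvalue.divergence X x) := by
    by_contra hn
    exact hX_div.ne' (Real.iInf_of_not_bddBelow hn)
  have hdiv : ∀ x ∈ Ω, h ≤ RiemannianEigenvalue.divergence X x :=
    fun x hx ↦ ciInf_le hbdd (⟨x, hx⟩ : Ω)
  have hXB : ∀ x ∈ Ω, ‖X x‖ ≤ B := fun x hx ↦ le_ciSup hX_bdd (⟨x, hx⟩ : Ω)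
  have hB0 : 0 ≤ B := Real.iSup_nonneg fun _ ↦ norm_nonneg _
  have key : ∀ {φ : M → ℝ}, RiemannianEigenvalue.IsTestFunction n Ω φ →
      h ^ 2 * ∫ x in Ω, φ x ^ 2 ∂(RiemannianEigenvalue.riemannianVolume n M) ≤
        (2 * B) ^ 2 * RiemannianEigenvalue.gradientIntegral n Ω φ :=
    fun hφ ↦ hφ.sq_mul_integral_sq_le hX hX_div hdiv hXB
  have sq_pos_of_ne : ∀ {f : M → ℝ},
      MemLp f 2 ((RiemannianEigenvalue.riemannianVolume n M).restrict Ω) →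
      ¬ f =ᵐ[(RiemannianEigenvalue.riemannianVolume n M).restrict Ω] 0 →
      0 < ∫ x in Ω, f x ^ 2 ∂(RiemannianEigenvalue.riemannianVolume n M) := by
    intro f hf hf0
    refine lt_of_le_of_ne (integral_nonneg fun x ↦ sq_nonneg _) fun h0 ↦ hf0 ?_
    have h1 := (integral_eq_zero_iff_of_nonneg (fun x ↦ sq_nonneg (f x)) hf.integrable_sq).1 h0.symm
    filter_upwards [h1] with x hx
    simpa using hx
  obtain ⟨p, hp⟩ := hne
  obtain ⟨u, hu, hu0, hup⟩ :=
    RiemannianEigenvalue.exists_isTestFunction (n := n) (hΩ_open.mem_nhds hp)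
  -- A continuous function vanishing almost everywhere on the open set Ω vanishes at every point of
  -- it, but u p = 1.
  have hu_ne : ¬ u =ᵐ[(RiemannianEigenvalue.riemannianVolume n M).restrict Ω] 0 := by
    have := RiemannianEigenvalue.riemannianVolume_isOpenPosMeasure (n := n) (M := M)
    intro hae
    have h1 := Measure.eqOn_open_of_ae_eq hae hΩ_open hu.smooth.continuous.continuousOn
      continuousOn_const hp
    simp [hup] at h1
  -- If B were 0, the inequality for the bump function u would read h² ∫ u² ≤ 0.
  have hBpos : 0 < B := by
    refine lt_of_le_of_ne hB0 fun hB1 ↦ ?_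
    have h1 := key hu
    rw [← hB1, mul_zero, zero_pow two_ne_zero, zero_mul] at h1
    exact h1.not_gt (mul_pos (pow_pos hX_div 2) (sq_pos_of_ne hu.memLp hu_ne))
  -- The function u shows that the set of Rayleigh quotients is nonempty; the real infimum of the
  -- empty set would be 0.
  refine ⟨le_csInf ⟨_, u, _, hu.hasDirichletEnergy, hu_ne, rfl⟩ ?_, by positivity⟩
  rintro _ ⟨f, D, ⟨hf, φ, hφ, -, hlim, hD⟩, hf0, rfl⟩
  rw [div_pow, le_div_iff₀ (sq_pos_of_ne hf hf0), div_mul_eq_mul_div,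
    div_le_iff₀ (by positivity), mul_comm D]
  -- The inequality for test functions passes to the limit: L² convergence handles ∫ φ_k², and the
  -- energies converge to D by definition.
  exact le_of_tendsto_of_tendsto'
    ((RiemannianEigenvalue.tendsto_integral_sq_of_tendsto_eLpNorm
      (fun k ↦ (hφ k).memLp) hf hlim).const_mul _)
    (hD.const_mul _) fun k ↦ key (hφ k)
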